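/- Let $n\ge 1$ and let $\mathcal S^n$ be the space of real symmetric $n\times n$ matrices with $\langle X,Y\rangle=\operatorname{tr}(XY)$. Let $\mathcal K=\mathcal{DNN}_n=\mathcal S^n_+\cap\mathcal N^n$ be the doubly nonnegative cone, where $\mathcal S^n_+$ is the cone of positive semidefinite matrices and $\mathcal N^n$ the cone of symmetric matrices with nonnegative entries. Let $m\ge 0$, let $\mathcal A:\mathcal S^n\to\mathbb R^m$ be linear with adjoint $\mathcal A^{\mathsf T}$, and let $b\in\mathbb R^m$, $c\in\mathcal S^n$. Consider $$(P)\quad \inf\{\langle c,x\rangle : \mathcal A x=b,\ x\in\mathcal K^*\},\qquad (D)\quad \sup\{\langle b,y\rangle : c-\mathcal A^{\mathsf T}y\in\mathcal K\},$$ with values $\theta_P,\theta_D\in[-\infty,+\infty]$ ($\theta_P=+\infty$, respectively $\theta_D=-\infty$, when the problem is infeasible), where $\mathcal F^*=\{s : \langle s,x\rangle\ge 0\ \forall x\in\mathcal F\}$. The generic facial reduction algorithm for $(D)$ starts with $\mathcal F_1=\mathcal K$. At step $i$ it chooses some $d_i\in\mathcal F_i^*\cap\ker\mathcal A$ with either (i)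 $\langle c,d_i\rangle=0$ and $d_i\notin\mathcal F_i^\perp$, or (ii) $\langle c,d_i\rangle<0$. In case (i) it puts $\mathcal F_{i+1}=\mathcal F_i\cap\{d_i\}^\perp$ and continues; in case (ii) it stops and returns $\emptyset$ as the minimal face; if there is no such $d_i$, it stops and returns $\mathcal F_i$ as the minimal face. The singularity degree $d(D)$ is the least possible number of directions $d_1,\dots,d_\ell$ found in a terminating run. The distance to strong duality $\mathrm{dist}_S(D)$ is the least number $\ell$ of facial reduction steps of type (i), leading from $\mathcal K$ to some $\mathcal F_{\ell+1}$, such that the problem $(\hat P)$: $\inf\{\langle c,x\rangle : \mathcal A x=b,\ x\in\mathcal F_{\ell+1}^*\}$ satisfies $\theta_{\hat P}=\theta_D$, the value $\theta_{\hat P}$ being moreover attained if $-\infty<\theta_D<+\infty$ (it is $+\infty$ if there is no such $\ell$). Then $d(D)\le n$. If moreover at least one of $(P)$, $(D)$ is feasible, then $\mathrm{dist}_S(D)\le n-1$. -/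

import Mathlib

open scoped Matrix

noncomputable section

/-! ## Conic linear programs, facial reduction, singularity degree, distance to strong duality

For a closed convex cone `K` in a Euclidean space `E`, a linear map `A : E → ℝᵐ`, `b ∈ ℝᵐ`, `c ∈ E`:

* (P)  inf ⟪c, x⟫  subject to  A x = b,  x ∈ K*,
* (D)  sup ⟪b, y⟫  subject to  c - Aᵀ y ∈ K.

The dual cone of a set `F` is `ProperCone.innerDual F = {s | ⟪x, s⟫ ≥ 0 for all x ∈ F}`. -/

namespace ConicProgram

variable {E : Type*} [NormedAddCommGroup E] [InnerProductSpace ℝ E] [FiniteDimensional ℝ E] {m : ℕ}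

/-- Feasible set of the primal problem over the dual of the set `F`: `A x = b`, `x ∈ F*`. -/
def primalFeasible (F : Set E) (A : E →ₗ[ℝ] EuclideanSpace ℝ (Fin m))
    (b : EuclideanSpace ℝ (Fin m)) : Set E :=
  {x | x ∈ ProperCone.innerDual F ∧ A x = b}

/-- Optimal value `inf {⟪c, x⟫ | A x = b, x ∈ F*}` in `[-∞, +∞]`; it is `+∞` if infeasible. -/
def primalValue (F : Set E) (A : E →ₗ[ℝ] EuclideanSpace ℝ (Fin m))
    (b : EuclideanSpace ℝ (Fin m)) (c : E) : EReal :=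
  ⨅ x ∈ primalFeasible F A b, ((inner ℝ c x : ℝ) : EReal)

/-- Feasible set of (D): the `y` with `c - Aᵀ y ∈ F`. -/
def dualFeasible (F : Set E) (A : E →ₗ[ℝ] EuclideanSpace ℝ (Fin m)) (c : E) :
    Set (EuclideanSpace ℝ (Fin m)) :=
  {y | c - LinearMap.adjoint A y ∈ F}

/-- Optimal value `sup {⟪b, y⟫ | c - Aᵀ y ∈ F}` in `[-∞, +∞]`; it is `-∞` if infeasible. -/
def dualValue (F : Set E) (A : E →ₗ[ℝ] EuclideanSpace ℝ (Fin m))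
    (b : EuclideanSpace ℝ (Fin m)) (c : E) : EReal :=
  ⨆ y ∈ dualFeasible F A c, ((inner ℝ b y : ℝ) : EReal)

/-- `d ∈ F* ∩ ker A` with `⟪c, d⟫ = 0` and `d ∉ F^⊥`. -/
def IsReducingDirection (F : Set E) (A : E →ₗ[ℝ] EuclideanSpace ℝ (Fin m)) (c d : E) : Prop :=
  d ∈ ProperCone.innerDual F ∧ A d = 0 ∧ inner ℝ c d = 0 ∧ ¬ ∀ x ∈ F, inner ℝ x d = 0

/-- `d ∈ F* ∩ ker A` with `⟪c, d⟫ < 0`. -/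
def IsInfeasibilityDirection (F : Set E) (A : E →ₗ[ℝ] EuclideanSpace ℝ (Fin m)) (c d : E) : Prop :=
  d ∈ ProperCone.innerDual F ∧ A d = 0 ∧ inner ℝ c d < 0

/-- The facial reduction step: `F ∩ {d}^⊥`. -/
def reduce (F : Set E) (d : E) : Set E :=
  F ∩ {x | inner ℝ x d = 0}

/-- The generic facial reduction algorithm for (D). `GenericFRA A c F ds M` says that, started at the
face `F`, the algorithm can terminate having found the directions `ds` (in this order) and returning
`M` as the minimal face. -/
inductive GenericFRA (A : E →ₗ[ℝ] EuclideanSpace ℝ (Fin m)) (c : E) :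
    Set E → List E → Set E → Prop
  | minimal (F : Set E)
      (h₁ : ∀ d, ¬ IsReducingDirection F A c d) (h₂ : ∀ d, ¬ IsInfeasibilityDirection F A c d) :
      GenericFRA A c F [] F
  | infeasible (F : Set E) (d : E) (h : IsInfeasibilityDirection F A c d) :
      GenericFRA A c F [d] ∅
  | step (F : Set E) (d : E) (ds : List E) (M : Set E) (h : IsReducingDirection F A c d)
      (hr : GenericFRA A c (reduce F d) ds M) :
      GenericFRA A c F (d :: ds) M

/-- `ReducesTo A c F ds G`: the facial reduction steps along the directions `ds`, started at the
face `F`, are valid and lead to the face `G`. -/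
inductive ReducesTo (A : E →ₗ[ℝ] EuclideanSpace ℝ (Fin m)) (c : E) :
    Set E → List E → Set E → Prop
  | nil (F : Set E) : ReducesTo A c F [] F
  | cons (F : Set E) (d : E) (ds : List E) (G : Set E) (h : IsReducingDirection F A c d)
      (hr : ReducesTo A c (reduce F d) ds G) :
      ReducesTo A c F (d :: ds) G

/-- The singularity degree `d(D)`: the least number of directions in an output of the generic facial
reduction algorithm (`⊤` if there were no output). -/
def singularityDegree (K : ProperCone ℝ E) (A : E →ₗ[ℝ] EuclideanSpace ℝ (Fin m)) (c : E) : ℕ∞ :=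
  sInf {k : ℕ∞ | ∃ (ds : List E) (M : Set E),
    GenericFRA A c (K : Set E) ds M ∧ k = (ds.length : ℕ∞)}

/-- Replacing `K*` by `F*` in (P) closes the duality gap with (D), and, when the value of (D) is
finite, makes the primal value attained. -/
def RestoresStrongDuality (K : ProperCone ℝ E) (A : E →ₗ[ℝ] EuclideanSpace ℝ (Fin m))
    (b : EuclideanSpace ℝ (Fin m)) (c : E) (F : Set E) : Prop :=
  primalValue F A b c = dualValue (K : Set E) A b c ∧
    (⊥ < dualValue (K : Set E) A b c → dualValue (K : Set E) A b c < ⊤ →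
      ∃ x ∈ primalFeasible F A b, ((inner ℝ c x : ℝ) : EReal) = primalValue F A b c)

/-- The distance to strong duality of (D): the least number of facial reduction steps at (D) that
restore strong duality (`⊤` if no sequence of steps does). -/
def distStrongDuality (K : ProperCone ℝ E) (A : E →ₗ[ℝ] EuclideanSpace ℝ (Fin m))
    (b : EuclideanSpace ℝ (Fin m)) (c : E) : ℕ∞ :=
  sInf {k : ℕ∞ | ∃ (ds : List E) (F : Set E), ReducesTo A c (K : Set E) ds F ∧
    RestoresStrongDuality K A b c F ∧ k = (ds.length : ℕ∞)}

end ConicProgram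

/-! ## Symmetric matrices with the trace inner product -/

/-- The subspace of symmetric matrices. -/
def symMatSubmodule (n : ℕ) : Submodule ℝ (Matrix (Fin n) (Fin n) ℝ) where
  carrier := {X | X.IsSymm}
  add_mem' hX hY := hX.add hY
  zero_mem' := Matrix.isSymm_zero
  smul_mem' r _ hX := hX.smul r

/-- The space of real symmetric `n × n` matrices. It is a separate type so that its only norm and
topology are those of the trace inner product. -/
def SymMat (n : ℕ) : Type := symMatSubmodule n

namespace SymMat

variable {n : ℕ}

/-- The underlying matrix. -/
def mat (X : SymMat n) : Matrix (Fin n) (Fin n) ℝ := X.1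

theorem isSymm (X : SymMat n) : X.mat.IsSymm := X.2

@[ext] theorem ext {X Y : SymMat n} (h : X.mat = Y.mat) : X = Y := Subtype.ext h

instance : AddCommGroup (SymMat n) := inferInstanceAs (AddCommGroup (symMatSubmodule n))

instance : Module ℝ (SymMat n) := inferInstanceAs (Module ℝ (symMatSubmodule n))

instance : FiniteDimensional ℝ (SymMat n) :=
  inferInstanceAs (FiniteDimensional ℝ (symMatSubmodule n))

@[simp] theorem mat_add (X Y : SymMat n) : (X + Y).mat = X.mat + Y.mat := rfl

@[simp] theorem mat_zero : (0 : SymMat n).mat = 0 := rfl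

@[simp] theorem mat_smul (r : ℝ) (X : SymMat n) : (r • X).mat = r • X.mat := rfl

/-- The trace inner product `⟪X, Y⟫ = tr (X Y)`. -/
@[reducible] def innerCore (n : ℕ) : InnerProductSpace.Core ℝ (SymMat n) where
  inner X Y := (X.mat * Y.mat).trace
  conj_inner_symm X Y := by simp [Matrix.trace_mul_comm X.mat Y.mat]
  re_inner_nonneg X := by
    have h : X.mat * X.mat = X.matᴴ * X.mat := by
      rw [Matrix.conjTranspose_eq_transpose_of_trivial, X.isSymm.eq]
    change 0 ≤ (X.mat * X.mat).trace
    rw [h]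
    exact (Matrix.posSemidef_conjTranspose_mul_self X.mat).trace_nonneg
  add_left X Y Z := by simp [add_mul]
  smul_left X Y r := by simp
  definite X h := by
    have h' : (X.matᴴ * X.mat).trace = 0 := by
      rw [Matrix.conjTranspose_eq_transpose_of_trivial, X.isSymm.eq]; exact h
    exact ext (Matrix.trace_conjTranspose_mul_self_eq_zero_iff.mp h')

instance : NormedAddCommGroup (SymMat n) := (innerCore n).toNormedAddCommGroup

instance : InnerProductSpace ℝ (SymMat n) := InnerProductSpace.ofCore (innerCore n).toCore

theorem inner_def (X Y : SymMat n) : inner ℝ X Y = (X.mat * Y.mat).trace := rfl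

/-- `X ↦ X.mat` as a linear map. -/
def matₗ (n : ℕ) : SymMat n →ₗ[ℝ] Matrix (Fin n) (Fin n) ℝ where
  toFun := mat
  map_add' _ _ := rfl
  map_smul' _ _ := rfl

theorem continuous_mat : Continuous (mat : SymMat n → Matrix (Fin n) (Fin n) ℝ) :=
  (matₗ n).continuous_of_finiteDimensional

theorem continuous_apply (i j : Fin n) : Continuous fun X : SymMat n => X.mat i j :=
  continuous_mat.matrix_elem i j

end SymMat

/-- The cone of symmetric positive semidefinite matrices. -/
def psdCone (n : ℕ) : ProperCone ℝ (SymMat n) where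
  carrier := {X | X.mat.PosSemidef}
  add_mem' hX hY := Matrix.PosSemidef.add hX hY
  zero_mem' := Matrix.PosSemidef.zero
  smul_mem' r _ hX := Matrix.PosSemidef.smul hX r.2
  isClosed' := by
    have h : {X : SymMat n | X.mat.PosSemidef} =
        ⋂ v : Fin n → ℝ, {X : SymMat n | 0 ≤ v ⬝ᵥ (X.mat *ᵥ v)} := by
      ext X
      simp only [Set.mem_ofPred_eq, Set.mem_iInter]
      constructor
      · intro hX v
        simpa using hX.dotProduct_mulVec_nonneg v
      · intro hX
        refine Matrix.PosSemidef.of_dotProduct_mulVec_nonneg ?_ (fun v => by simpa using hX v)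
        rw [Matrix.IsHermitian, Matrix.conjTranspose_eq_transpose_of_trivial]
        exact X.isSymm
    change IsClosed {X : SymMat n | X.mat.PosSemidef}
    rw [h]
    exact isClosed_iInter fun v => isClosed_le continuous_const
      (continuous_const.dotProduct (SymMat.continuous_mat.matrix_mulVec continuous_const))

/-- The cone of symmetric matrices with nonnegative entries. -/
def nonnegCone (n : ℕ) : ProperCone ℝ (SymMat n) where
  carrier := {X | ∀ i j, 0 ≤ X.mat i j}
  add_mem' hX hY i j := add_nonneg (hX i j) (hY i j)
  zero_mem' _ _ := le_rfl
  smul_mem' r _ hX i j := mul_nonneg r.2 (hX i j)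
  isClosed' := by
    have h : {X : SymMat n | ∀ i j, 0 ≤ X.mat i j} =
        ⋂ i, ⋂ j, {X : SymMat n | 0 ≤ X.mat i j} := by
      ext X; simp
    change IsClosed {X : SymMat n | ∀ i j, 0 ≤ X.mat i j}
    rw [h]
    exact isClosed_iInter fun i => isClosed_iInter fun j =>
      isClosed_le continuous_const (SymMat.continuous_apply i j)

/-- The doubly nonnegative cone. -/
def dnnCone (n : ℕ) : ProperCone ℝ (SymMat n) := psdCone n ⊓ nonnegCone n

end

/-! The cone is written as `S ∩ P`, with `S` the positive semidefinite cone and `P` the polyhedral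
cone of entrywise inequalities. The relevant constraint qualification is a partially polyhedral
Slater condition: some slack lies in the relative interior of `S` and merely inside `P`. Under it
the primal over `(S ∩ P)*` has no gap and attains a finite value.

If the condition fails, a theorem of the alternative (separation from the relative interior of `S`,
with Farkas' lemma for `P`) gives either an infeasibility direction or `d + t` in `ker A`,
orthogonal to `c`, with `d ∈ S*` nonzero on `S` and `t ∈ P*`. Then `(S ∩ P) ∩ {d + t}^⊥ = (S ∩
{d}^⊥) ∩ (P ∩ {t}^⊥)`, again a cone meeting a polyhedral one, with `S` replaced by a proper face.
Faces of the semidefinite cone come from subspaces, so each such step lowers a dimension. After `n -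
1` steps the dimension is at most one and the face is a ray, which is polyhedral. It can then be
absorbed into `P`, and Slater reduces to feasibility.

Hence `n - 1` steps suffice for strong duality. An infeasibility direction is not counted there: it
shows that (D) is infeasible, and feasibility of (P) then drives the primal value to `-∞`. Reaching
the minimal face costs one more direction, which exposes all implicit equalities of `P` at once. -/

noncomputable section

/-! ### Farkas' lemma -/

/-- **Farkas' lemma**: a linear functional that is nonnegative on a polyhedral cone is a nonnegative
combination of the functionals that define the cone. -/
theorem exists_nonneg_combination_of_nonneg_on {Y ι : Type*} [AddCommGroup Y] [Module ℝ Y]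
    (s : Finset ι) (g : ι → Y →ₗ[ℝ] ℝ) (f : Y →ₗ[ℝ] ℝ)
    (h : ∀ y, (∀ i ∈ s, 0 ≤ g i y) → 0 ≤ f y) :
    ∃ w : ι → ℝ, (∀ i, 0 ≤ w i) ∧ ∀ y, f y = ∑ i ∈ s, w i * g i y := by
  classical
  induction s using Finset.induction_on generalizing g f with
  | empty =>
    refine ⟨0, fun _ => le_rfl, fun y => ?_⟩
    have h₁ := h y (by simp)
    have h₂ := h (-y) (by simp)
    rw [map_neg] at h₂
    simp
    linarith
  | insert a s ha ih =>
    by_cases hs : ∀ y, (∀ i ∈ s, 0 ≤ g i y) → 0 ≤ f y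
    · obtain ⟨w, hw, hf⟩ := ih g f hs
      refine ⟨fun i => if i = a then 0 else w i, fun i => ?_, fun y => ?_⟩
      · dsimp only; split_ifs
        exacts [le_rfl, hw i]
      · rw [hf, Finset.sum_insert ha]
        simp only [↓reduceIte, zero_mul, zero_add]
        refine Finset.sum_congr rfl fun i hi => ?_
        rw [if_neg (by rintro rfl; exact ha hi)]
    · push Not at hs
      obtain ⟨y₁, hy₁, hfy₁⟩ := hs
      have hga : g a y₁ < 0 := by
        by_contra! hga
        exact absurd (h y₁ (by simpa [hga] using hy₁)) (not_le.mpr hfy₁)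
      obtain ⟨y₀, hy₀, hfy₀, hga₀⟩ : ∃ y₀, (∀ i ∈ s, 0 ≤ g i y₀) ∧ f y₀ < 0 ∧ g a y₀ = -1 := by
        refine ⟨(-g a y₁)⁻¹ • y₁, fun i hi => ?_, ?_, ?_⟩
        · rw [map_smul, smul_eq_mul]
          exact mul_nonneg (inv_nonneg.mpr (by linarith)) (hy₁ i hi)
        · rw [map_smul, smul_eq_mul]
          exact mul_neg_of_pos_of_neg (inv_pos.mpr (by linarith)) hfy₁
        · rw [map_smul, smul_eq_mul]
          rw [inv_neg, neg_mul, inv_mul_cancel₀ hga.ne]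
      -- `P` is the projection onto `ker (g a)` along `y₀`. The constraint `a` holds trivially on
      -- its image, so the induction hypothesis applies to the functionals composed with `P`.
      let P : Y →ₗ[ℝ] Y := LinearMap.id + (g a).smulRight y₀
      have hP : ∀ (k : Y →ₗ[ℝ] ℝ) y, k (P y) = k y + g a y * k y₀ := fun k y => by simp [P]
      obtain ⟨w, hw, hf⟩ := ih (fun i => g i ∘ₗ P) (f ∘ₗ P) (fun y hy => by
        refine h (P y) fun i hi => ?_
        rcases Finset.mem_insert.mp hi with rfl | hi
        · rw [hP, hga₀]; simp
        · exact hy i hi)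
      simp only [LinearMap.comp_apply, hP, mul_add, Finset.sum_add_distrib] at hf
      have hsum : 0 ≤ ∑ i ∈ s, w i * g i y₀ :=
        Finset.sum_nonneg fun i hi => mul_nonneg (hw i) (hy₀ i hi)
      refine ⟨fun i => if i = a then ∑ i ∈ s, w i * g i y₀ - f y₀ else w i, fun i => ?_,
        fun y => ?_⟩
      · dsimp only; split_ifs
        exacts [by linarith, hw i]
      · rw [Finset.sum_insert ha]
        have h₂ : ∀ r : ℝ, ∑ i ∈ s, (if i = a then r else w i) * g i y = ∑ i ∈ s, w i * g i y :=
          fun r => Finset.sum_congr rfl fun i hi => by rw [if_neg (by rintro rfl; exact ha hi)]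
        rw [h₂]
        dsimp only
        rw [if_pos rfl]
        have h₁ : ∑ i ∈ s, w i * (g a y * g i y₀) = g a y * ∑ i ∈ s, w i * g i y₀ := by
          rw [Finset.mul_sum]
          exact Finset.sum_congr rfl fun i _ => by ring
        have := hf y
        rw [h₁] at this
        linarith

/-! ### Relative interiors, separation and a theorem of the alternative -/

namespace PointedCone

variable {E : Type*} [NormedAddCommGroup E] [NormedSpace ℝ E]

/-- The relative interior of a cone `S`, described algebraically: from `x` one can move a little in
the direction opposite to any element of `S` without leaving `S`. -/
def relint (S : PointedCone ℝ E) : Set E :=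
  {x | x ∈ S ∧ ∀ z ∈ S, ∃ ε > (0 : ℝ), x - ε • z ∈ S}

variable {S : PointedCone ℝ E}

theorem relint_add_mem {x z : E} (hx : x ∈ relint S) (hz : z ∈ S) : x + z ∈ relint S := by
  refine ⟨S.add_mem hx.1 hz, fun w hw => ?_⟩
  obtain ⟨ε, hε, h⟩ := hx.2 w hw
  refine ⟨ε, hε, ?_⟩
  rw [add_sub_right_comm]
  exact S.add_mem h hz

theorem smul_mem_relint {x : E} (hx : x ∈ relint S) {r : ℝ} (hr : 0 < r) : r • x ∈ relint S := by
  refine ⟨PointedCone.smul_mem _ hr.le hx.1, fun w hw => ?_⟩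
  obtain ⟨ε, hε, h⟩ := hx.2 w hw
  refine ⟨r * ε, mul_pos hr hε, ?_⟩
  rw [mul_smul, ← smul_sub]
  exact PointedCone.smul_mem _ hr.le h

theorem map_pos_of_mem_relint {x z : E} (hx : x ∈ relint S) {φ : E →ₗ[ℝ] ℝ}
    (hφ : ∀ w ∈ S, 0 ≤ φ w) (hz : z ∈ S) (hφz : 0 < φ z) : 0 < φ x := by
  obtain ⟨ε, hε, h⟩ := hx.2 z hz
  have := hφ _ h
  rw [map_sub, map_smul, smul_eq_mul] at this
  nlinarith [mul_pos hε hφz]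

variable [FiniteDimensional ℝ E]

/-- A cone that misses the relative interior of `S` is properly separated from `S` inside the span of
`S`. -/
theorem exists_separating_of_disjoint_relint (S D : PointedCone ℝ E)
    (hD : ∀ x ∈ D, x ∈ Submodule.span ℝ (S : Set E)) (hdisj : ∀ x ∈ D, x ∉ relint S) :
    ∃ φ : E →ₗ[ℝ] ℝ, (∀ x ∈ S, 0 ≤ φ x) ∧ (∃ x ∈ S, 0 < φ x) ∧ ∀ x ∈ D, φ x ≤ 0 := by
  set V := Submodule.span ℝ (S : Set E) with hV
  let C : Set V := {v | (v : E) ∈ S}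
  have hCconv : Convex ℝ C := by
    intro x hx y hy a b ha hb _
    exact S.add_mem (PointedCone.smul_mem _ ha hx) (PointedCone.smul_mem _ hb hy)
  have hne : (interior C).Nonempty := by
    rw [hCconv.interior_nonempty_iff_affineSpan_eq_top]
    have h0 : (0 : V) ∈ C := S.zero_mem
    have : affineSpan ℝ C = (Submodule.span ℝ C).toAffineSubspace :=
      SetLike.coe_injective (by
        have := affineSpan_insert_zero (k := ℝ) C
        rwa [Set.insert_eq_of_mem h0] at this)
    rw [this]
    have hspan : Submodule.span ℝ C = ⊤ := Submodule.span_span_coe_preimage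
    rw [hspan]; rfl
  have hri : ∀ v ∈ interior C, (v : E) ∈ relint S := by
    intro v hv
    refine ⟨interior_subset (s := C) hv, fun z hz => ?_⟩
    let z' : V := ⟨z, Submodule.subset_span hz⟩
    have hcont : Filter.Tendsto (fun ε : ℝ => v - ε • z') (nhdsWithin 0 (Set.Ioi 0)) (nhds v) := by
      have : Continuous fun ε : ℝ => v - ε • z' := by fun_prop
      simpa using (this.tendsto 0).mono_left nhdsWithin_le_nhds
    obtain ⟨ε, h₁, h₂⟩ := ((hcont.eventually (mem_interior_iff_mem_nhds.mp hv)).and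
      self_mem_nhdsWithin).exists
    exact ⟨ε, h₂, h₁⟩
  let D' : Set V := {v | (v : E) ∈ D}
  have hD'conv : Convex ℝ D' := by
    intro x hx y hy a b ha hb _
    exact D.add_mem (PointedCone.smul_mem _ ha hx) (PointedCone.smul_mem _ hb hy)
  obtain ⟨f, u, hf, hfD⟩ := geometric_hahn_banach_open hCconv.interior isOpen_interior hD'conv
    (Set.disjoint_left.mpr fun v hv hvD => hdisj v hvD (hri v hv))
  have hu : u ≤ 0 := by simpa using hfD 0 D.zero_mem
  have hfC : ∀ v ∈ C, f v ≤ u := by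
    intro v hv
    have : v ∈ closure (interior C) := by
      rw [hCconv.closure_interior_eq_closure_of_nonempty_interior hne]
      exact subset_closure hv
    exact closure_minimal (fun w hw => (hf w hw).le)
      (isClosed_le f.continuous continuous_const) this
  obtain ⟨φ, hφ⟩ := LinearMap.exists_extend (-(f : V →ₗ[ℝ] ℝ))
  have hφ' : ∀ v : V, φ v = -f v := fun v => LinearMap.congr_fun hφ v
  refine ⟨φ, fun x hx => ?_, ?_, fun x hx => ?_⟩
  · have := hfC ⟨x, Submodule.subset_span hx⟩ hx
    rw [hφ' ⟨x, Submodule.subset_span hx⟩]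
    linarith
  · obtain ⟨v, hv⟩ := hne
    refine ⟨v, interior_subset (s := C) hv, ?_⟩
    rw [hφ']
    linarith [hf v hv]
  · rw [hφ' ⟨x, hD x hx⟩]
    by_contra! hneg
    have h₁ : f ⟨x, hD x hx⟩ < 0 := by linarith
    -- A functional bounded below on a cone is nonnegative there: otherwise a large multiple of `x`
    -- falls below the bound `u`.
    obtain ⟨r, hr, hlt⟩ : ∃ r : ℝ, 0 ≤ r ∧ r * f ⟨x, hD x hx⟩ < u := by
      refine ⟨(u - 1) / f ⟨x, hD x hx⟩, div_nonneg_of_nonpos (by linarith) h₁.le, ?_⟩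
      rw [div_mul_cancel₀ _ h₁.ne]
      linarith
    have := hfD (r • ⟨x, hD x hx⟩) (PointedCone.smul_mem _ hr hx)
    rw [map_smul, smul_eq_mul] at this
    linarith

/-- A theorem of the alternative for the relative interior of a cone and finitely many further linear
inequalities. -/
theorem exists_dual_certificate_of_disjoint_relint {Y ι : Type*} [AddCommGroup Y] [Module ℝ Y]
    (S : PointedCone ℝ E) (T : Y →ₗ[ℝ] E) (s : Finset ι) (g : ι → Y →ₗ[ℝ] ℝ)
    (h : ∀ y, (∀ i ∈ s, 0 ≤ g i y) → T y ∉ relint S) :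
    ∃ φ : E →ₗ[ℝ] ℝ, (∀ x ∈ S, 0 ≤ φ x) ∧ (∃ x ∈ S, 0 < φ x) ∧
      ∃ w : ι → ℝ, (∀ i, 0 ≤ w i) ∧ ∀ y, φ (T y) + ∑ i ∈ s, w i * g i y = 0 := by
  set V := Submodule.span ℝ (S : Set E) with hV
  let D : PointedCone ℝ E :=
    { carrier := {x | ∃ y, T y = x ∧ T y ∈ V ∧ ∀ i ∈ s, 0 ≤ g i y}
      add_mem' := by
        rintro _ _ ⟨y, rfl, hyV, hy⟩ ⟨z, rfl, hzV, hz⟩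
        refine ⟨y + z, map_add _ _ _, ?_, fun i hi => ?_⟩
        · rw [map_add]; exact V.add_mem hyV hzV
        · rw [map_add]; exact add_nonneg (hy i hi) (hz i hi)
      zero_mem' := ⟨0, by simp⟩
      smul_mem' := by
        rintro ⟨r, hr⟩ _ ⟨y, rfl, hyV, hy⟩
        refine ⟨r • y, map_smul _ _ _, ?_, fun i hi => ?_⟩
        · rw [map_smul]; exact V.smul_mem r hyV
        · rw [map_smul]; exact mul_nonneg hr (hy i hi) }
  obtain ⟨φ, hφ, hpos, hφD⟩ := exists_separating_of_disjoint_relint S D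
    (by rintro _ ⟨y, rfl, hy, -⟩; exact hy) (by rintro _ ⟨y, rfl, -, hy⟩; exact h y hy)
  -- Separation controls `φ ∘ T` only where `T` lands in the span `V`, so Farkas gives the identity
  -- on `W` alone. The error `ψ` vanishes on `W`, hence factors through `E ⧸ V`. Subtracting that
  -- factor from `φ` makes the identity global without changing `φ` on `S`.
  let W := V.comap T
  obtain ⟨w, hw, heq⟩ := exists_nonneg_combination_of_nonneg_on s (fun i => g i ∘ₗ W.subtype)
    (-(φ ∘ₗ T ∘ₗ W.subtype)) (fun y hy => by
      have := hφD _ ⟨y, rfl, y.2, hy⟩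
      simpa using this)
  let ψ : Y →ₗ[ℝ] ℝ := φ ∘ₗ T + ∑ i ∈ s, w i • g i
  have hψ : ψ ∈ (V.mkQ ∘ₗ T).ker.dualAnnihilator := by
    rw [Submodule.mem_dualAnnihilator]
    intro y hy
    have hyW : y ∈ W := by simpa [W] using hy
    have := heq ⟨y, hyW⟩
    simp only [LinearMap.neg_apply, LinearMap.comp_apply, Submodule.subtype_apply] at this
    simp only [ψ, LinearMap.add_apply, LinearMap.comp_apply, LinearMap.sum_apply,
      LinearMap.smul_apply, smul_eq_mul, ← this]
    ring
  rw [← LinearMap.range_dualMap_eq_dualAnnihilator_ker] at hψ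
  obtain ⟨η, hη⟩ := hψ
  have hηV : ∀ x ∈ S, (φ - η ∘ₗ V.mkQ) x = φ x := fun x hx => by
    have : V.mkQ x = 0 := by simpa using Submodule.subset_span hx
    simp [this]
  refine ⟨φ - η ∘ₗ V.mkQ, fun x hx => ?_, ?_, w, hw, fun y => ?_⟩
  · rw [hηV x hx]; exact hφ x hx
  · obtain ⟨x, hx, hx'⟩ := hpos
    exact ⟨x, hx, by rwa [hηV x hx]⟩
  · have := LinearMap.congr_fun hη y
    simp only [ψ, LinearMap.dualMap_apply, LinearMap.add_apply, LinearMap.comp_apply,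
      LinearMap.sum_apply, LinearMap.smul_apply, smul_eq_mul] at this
    simp only [LinearMap.sub_apply, LinearMap.comp_apply, this]
    ring

end PointedCone

/-! ### The partially polyhedral Slater condition and strong duality -/

namespace ConicProgram

variable {E : Type*} [NormedAddCommGroup E] [InnerProductSpace ℝ E]

/-- The polyhedral cone `{x | ⟪x, e⟫ ≥ 0 for all e ∈ s}`. -/
def polyhedralCone (s : Finset E) : Set E :=
  {x | ∀ e ∈ s, 0 ≤ (inner ℝ x e : ℝ)}

theorem polyhedralCone_union [DecidableEq E] (s t : Finset E) :
    polyhedralCone (s ∪ t) = polyhedralCone s ∩ polyhedralCone t := by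
  ext x
  simp only [polyhedralCone, Finset.mem_union, Set.mem_ofPred_eq, Set.mem_inter_iff]
  exact ⟨fun h => ⟨fun e he => h e (.inl he), fun e he => h e (.inr he)⟩,
    fun h e he => he.elim (h.1 e) (h.2 e)⟩

theorem add_mem_polyhedralCone {s : Finset E} {x y : E} (hx : x ∈ polyhedralCone s)
    (hy : y ∈ polyhedralCone s) : x + y ∈ polyhedralCone s := fun e he => by
  rw [inner_add_left]
  exact add_nonneg (hx e he) (hy e he)

theorem smul_mem_polyhedralCone {s : Finset E} {x : E} (hx : x ∈ polyhedralCone s) {r : ℝ}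
    (hr : 0 ≤ r) : r • x ∈ polyhedralCone s := fun e he => by
  rw [real_inner_smul_left]
  exact mul_nonneg hr (hx e he)

theorem reduce_eq_self {F : Set E} {d : E} (h : ∀ x ∈ F, (inner ℝ x d : ℝ) = 0) :
    reduce F d = F :=
  Set.inter_eq_left.mpr h

variable [FiniteDimensional ℝ E] {m : ℕ}

-- This is the theorem of the alternative for the homogenised system in `(y, τ)`. The strict
-- inequality becomes a second coordinate in the relative interior of the half-line, and `τ ≥ 0`
-- joins the polyhedral constraints under the index `none`. The separating functional on `E × ℝ` is
-- the pair `(d, γ)`, and `t` collects the Farkas weights.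
open PointedCone in
theorem exists_relint_point_or_dual_certificate (S : PointedCone ℝ E) (s : Finset E)
    (A : E →ₗ[ℝ] EuclideanSpace ℝ (Fin m)) (b : EuclideanSpace ℝ (Fin m)) (c : E) (θ : ℝ) :
    (∃ (y : EuclideanSpace ℝ (Fin m)) (τ : ℝ), 0 ≤ τ ∧ τ • c - LinearMap.adjoint A y ∈ relint S ∧
      τ • c - LinearMap.adjoint A y ∈ polyhedralCone s ∧ θ * τ < inner ℝ b y) ∨
    ∃ (d t : E) (γ : ℝ), (∀ x ∈ S, 0 ≤ (inner ℝ x d : ℝ)) ∧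
      (∀ x ∈ polyhedralCone s, 0 ≤ (inner ℝ x t : ℝ)) ∧ 0 ≤ γ ∧ A (d + t) = γ • b ∧
      inner ℝ c (d + t) ≤ θ * γ ∧ (0 < γ ∨ ∃ x ∈ S, 0 < (inner ℝ x d : ℝ)) := by
  refine or_iff_not_imp_left.mpr fun hno => ?_
  let L : EuclideanSpace ℝ (Fin m) × ℝ →ₗ[ℝ] E :=
    (LinearMap.snd ℝ _ ℝ).smulRight c - LinearMap.adjoint A ∘ₗ LinearMap.fst ℝ _ ℝ
  have hL : ∀ y τ, L (y, τ) = τ • c - LinearMap.adjoint A y := fun y τ => by simp [L]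
  let T : EuclideanSpace ℝ (Fin m) × ℝ →ₗ[ℝ] E × ℝ :=
    L.prod (innerₗ _ b ∘ₗ LinearMap.fst ℝ _ ℝ - θ • LinearMap.snd ℝ _ ℝ)
  have hT : ∀ y τ, T (y, τ) = (τ • c - LinearMap.adjoint A y, inner ℝ b y - θ * τ) :=
    fun y τ => by simp [T, hL]
  let g : Option E → EuclideanSpace ℝ (Fin m) × ℝ →ₗ[ℝ] ℝ := fun o =>
    o.elim (LinearMap.snd ℝ _ ℝ) fun e => innerₗ E e ∘ₗ L
  let S' : PointedCone ℝ (E × ℝ) := Submodule.prod S (PointedCone.positive ℝ ℝ)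
  obtain ⟨φ, hφ, ⟨⟨x₀, r₀⟩, hx₀, hpos⟩, w, hw, heq⟩ :=
      exists_dual_certificate_of_disjoint_relint S' T (Finset.insertNone s) g (by
    rintro ⟨y, τ⟩ hg hmem
    rw [hT] at hmem
    refine hno ⟨y, τ, hg none (by simp), ⟨hmem.1.1, fun z hz => ?_⟩, fun e he => ?_, ?_⟩
    · obtain ⟨ε, hε, h⟩ := hmem.2 (z, 0) ⟨hz, le_refl (0 : ℝ)⟩
      exact ⟨ε, hε, h.1⟩
    · have := hg (some e) (by simpa using he)
      rw [real_inner_comm, ← hL]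
      exact this
    · obtain ⟨ε, hε, h⟩ := hmem.2 (0, 1) ⟨S.zero_mem, zero_le_one (α := ℝ)⟩
      have : 0 ≤ inner ℝ b y - θ * τ - ε * 1 := h.2
      linarith)
  let d : E := (InnerProductSpace.toDual ℝ E).symm
    (LinearMap.toContinuousLinearMap (φ ∘ₗ LinearMap.inl ℝ E ℝ))
  have hd : ∀ x r, φ (x, r) = inner ℝ x d + r * φ (0, 1) := fun x r => by
    have h₁ : (x, r) = LinearMap.inl ℝ E ℝ x + r • ((0, 1) : E × ℝ) := by simp
    have h₂ : inner ℝ x d = φ (LinearMap.inl ℝ E ℝ x) := by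
      rw [real_inner_comm, InnerProductSpace.toDual_symm_apply]; rfl
    rw [h₁, map_add, map_smul, h₂, smul_eq_mul]
  set γ := φ (0, 1) with hγ
  have hγ0 : 0 ≤ γ := hφ _ ⟨S.zero_mem, zero_le_one (α := ℝ)⟩
  let t : E := ∑ e ∈ s, w (some e) • e
  have ht : ∀ x, inner ℝ x t = ∑ e ∈ s, w (some e) * inner ℝ e x := fun x => by
    simp only [t, inner_sum, real_inner_smul_right, real_inner_comm x]
  have key : ∀ y τ, inner ℝ (τ • c - LinearMap.adjoint A y) (d + t) + (inner ℝ b y - θ * τ) * γ +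
      w none * τ = 0 := by
    intro y τ
    have := heq (y, τ)
    rw [Finset.sum_insertNone, hT, hd] at this
    rw [inner_add_right, ht, ← this]
    simp only [g, Option.elim, LinearMap.snd_apply, LinearMap.comp_apply, innerₗ_apply_apply, hL]
    ring
  refine ⟨d, t, γ, fun x hx => ?_, fun x hx => ?_, hγ0, ?_, ?_, ?_⟩
  · have := hφ (x, 0) ⟨hx, le_refl (0 : ℝ)⟩
    rwa [hd, zero_mul, add_zero] at this
  · rw [ht]
    exact Finset.sum_nonneg fun e he => mul_nonneg (hw _) (by
      rw [real_inner_comm]; exact hx e he)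
  · refine ext_inner_left ℝ fun y => ?_
    have := key y 0
    rw [zero_smul, zero_sub, inner_neg_left, LinearMap.adjoint_inner_left] at this
    rw [real_inner_smul_right, real_inner_comm b y]
    linarith
  · have := key 0 1
    rw [map_zero, one_smul, sub_zero, inner_zero_right] at this
    linarith [hw none]
  · rcases hγ0.eq_or_lt with h | h
    · right
      refine ⟨x₀, hx₀.1, ?_⟩
      rwa [hd, ← h, mul_zero, add_zero] at hpos
    · exact Or.inl h

/-- The partially polyhedral Slater condition: some dual slack lies in the relative interior of `S`
and in the polyhedral cone of `s`. -/
def PartialPolyhedralSlater (S : PointedCone ℝ E) (s : Finset E)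
    (A : E →ₗ[ℝ] EuclideanSpace ℝ (Fin m)) (c : E) : Prop :=
  ∃ y, c - LinearMap.adjoint A y ∈ PointedCone.relint S ∧
    c - LinearMap.adjoint A y ∈ polyhedralCone s

variable {S : PointedCone ℝ E} {s : Finset E} {A : E →ₗ[ℝ] EuclideanSpace ℝ (Fin m)}
  {b : EuclideanSpace ℝ (Fin m)} {c : E}

theorem smul_inv_slack {τ : ℝ} (hτ : 0 < τ) (y : EuclideanSpace ℝ (Fin m)) :
    c - LinearMap.adjoint A (τ⁻¹ • y) = τ⁻¹ • (τ • c - LinearMap.adjoint A y) := by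
  rw [smul_sub, inv_smul_smul₀ hτ.ne', map_smul]

open PointedCone in
/-- If the partially polyhedral Slater condition fails, then there is an infeasibility direction or a
direction that exposes a proper face of `S`. -/
theorem exists_direction_of_not_partialPolyhedralSlater
    (h : ¬ PartialPolyhedralSlater S s A c) :
    (∃ d, IsInfeasibilityDirection ((S : Set E) ∩ polyhedralCone s) A c d) ∨
    ∃ d t : E, (∀ x ∈ S, 0 ≤ (inner ℝ x d : ℝ)) ∧ (∃ x ∈ S, 0 < (inner ℝ x d : ℝ)) ∧
      (∀ x ∈ polyhedralCone s, 0 ≤ (inner ℝ x t : ℝ)) ∧ A (d + t) = 0 ∧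
      inner ℝ c (d + t) = 0 := by
  -- With `b = 0` and `θ = -1`, the strict inequality reads `0 < τ`, so the point can be rescaled to
  -- a slack. In the certificate, `⟪c, d + t⟫ ≤ -γ`, so the value zero forces `γ = 0` and leaves
  -- only the case of `d` nonzero on `S`.
  rcases exists_relint_point_or_dual_certificate S s A 0 c (-1) with
    ⟨y, τ, -, hri, hpoly, hlt⟩ | ⟨d, t, γ, hd, ht, hγ, hA, hc, hor⟩
  · have hτ : 0 < τ := by
      rw [inner_zero_left] at hlt
      linarith
    refine absurd ⟨τ⁻¹ • y, ?_, ?_⟩ h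
    · rw [smul_inv_slack hτ]
      exact smul_mem_relint hri (inv_pos.mpr hτ)
    · rw [smul_inv_slack hτ]
      exact smul_mem_polyhedralCone hpoly (inv_pos.mpr hτ).le
  · rw [smul_zero] at hA
    have hmem : d + t ∈ ProperCone.innerDual ((S : Set E) ∩ polyhedralCone s) := by
      intro x hx
      change 0 ≤ (inner ℝ x _ : ℝ)
      rw [inner_add_right]
      exact add_nonneg (hd x hx.1) (ht x hx.2)
    rcases lt_or_eq_of_le (show inner ℝ c (d + t) ≤ 0 by linarith) with h₁ | h₁
    · exact Or.inl ⟨d + t, hmem, hA, h₁⟩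
    · rcases hor with h₂ | h₂
      · linarith
      · exact Or.inr ⟨d, t, hd, h₂, ht, hA, h₁⟩

open PointedCone in
/-- Strong duality with primal attainment under the partially polyhedral Slater condition. -/
theorem exists_primal_le_of_partialPolyhedralSlater (h : PartialPolyhedralSlater S s A c) {θ : ℝ}
    (hθ : ∀ y, c - LinearMap.adjoint A y ∈ (S : Set E) ∩ polyhedralCone s → inner ℝ b y ≤ θ) :
    ∃ x ∈ ProperCone.innerDual ((S : Set E) ∩ polyhedralCone s), A x = b ∧ inner ℝ c x ≤ θ := by
  obtain ⟨y₀, hy₀, hy₀'⟩ := h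
  rcases exists_relint_point_or_dual_certificate S s A b c θ with
    ⟨y, τ, hτ0, hri, hpoly, hlt⟩ | ⟨d, t, γ, hd, ht, hγ, hA, hc, hor⟩
  · exfalso
    rcases hτ0.eq_or_lt with rfl | hτ
    -- For `τ = 0` the point is a recession direction with positive objective, which makes the dual
    -- unbounded from `y₀`.
    · rw [mul_zero] at hlt
      rw [zero_smul] at hri hpoly
      obtain ⟨r, hr, hrlt⟩ : ∃ r : ℝ, 0 ≤ r ∧ θ < inner ℝ b y₀ + r * inner ℝ b y := by
        refine ⟨(|θ - inner ℝ b y₀| + 1) / inner ℝ b y, by positivity, ?_⟩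
        rw [div_mul_cancel₀ _ hlt.ne']
        linarith [le_abs_self (θ - inner ℝ b y₀)]
      have heq : c - LinearMap.adjoint A (y₀ + r • y) =
          (c - LinearMap.adjoint A y₀) + r • (0 - LinearMap.adjoint A y) := by
        rw [map_add, map_smul, smul_sub, smul_zero]
        abel
      have := hθ (y₀ + r • y) (by
        rw [heq]
        exact ⟨S.add_mem hy₀.1 (S.smul_mem hr hri.1),
          add_mem_polyhedralCone hy₀' (smul_mem_polyhedralCone hpoly hr)⟩)
      rw [inner_add_right, real_inner_smul_right] at this
      linarith
    · have := hθ (τ⁻¹ • y) (by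
        rw [smul_inv_slack hτ]
        exact ⟨S.smul_mem (inv_pos.mpr hτ).le hri.1,
          smul_mem_polyhedralCone hpoly (inv_pos.mpr hτ).le⟩)
      rw [real_inner_smul_right, inv_mul_le_iff₀ hτ] at this
      linarith
  · have hmem : d + t ∈ ProperCone.innerDual ((S : Set E) ∩ polyhedralCone s) := by
      intro x hx
      change 0 ≤ (inner ℝ x _ : ℝ)
      rw [inner_add_right]
      exact add_nonneg (hd x hx.1) (ht x hx.2)
    rcases hγ.eq_or_lt with rfl | hγ
    · exfalso
      rcases hor with h₂ | ⟨x, hx, hx'⟩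
      · exact lt_irrefl _ h₂
      -- Were `γ = 0`, the Slater slack would pair positively with `d` and nonnegatively with `t`,
      -- against `⟪c, d + t⟫ ≤ 0`.
      · have h₁ : 0 < (inner ℝ (c - LinearMap.adjoint A y₀) d : ℝ) := by
          have := map_pos_of_mem_relint (φ := innerₗ E d) hy₀
            (fun w hw => by simpa [real_inner_comm] using hd w hw) hx
            (by simpa [real_inner_comm] using hx')
          simpa [real_inner_comm] using this
        have h₂ := ht _ hy₀'
        have h₃ : (inner ℝ (c - LinearMap.adjoint A y₀) (d + t) : ℝ) = inner ℝ c (d + t) := by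
          rw [inner_sub_left, LinearMap.adjoint_inner_left, hA, zero_smul, inner_zero_right,
            sub_zero]
        rw [inner_add_right] at h₃
        linarith
    · refine ⟨γ⁻¹ • (d + t), ?_, ?_, ?_⟩
      · intro x hx
        change 0 ≤ (inner ℝ x _ : ℝ)
        rw [real_inner_smul_right]
        exact mul_nonneg (inv_pos.mpr hγ).le (hmem hx)
      · rw [map_smul, hA, inv_smul_smul₀ hγ.ne']
      · rw [real_inner_smul_right, inv_mul_le_iff₀ hγ]
        linarith

end ConicProgram

theorem PointedCone.eventually_sub_smul_mem {E : Type*} [NormedAddCommGroup E] [NormedSpace ℝ E]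
    {S : PointedCone ℝ E} {x z : E} (hx : x ∈ relint S) (hz : z ∈ S) :
    ∀ᶠ ε : ℝ in nhdsWithin 0 (Set.Ioi 0), x - ε • z ∈ S := by
  obtain ⟨ε, hε, h⟩ := hx.2 z hz
  filter_upwards [Ioo_mem_nhdsGT hε] with δ hδ
  have : x - δ • z = (1 - δ / ε) • x + (δ / ε) • (x - ε • z) := by
    rw [smul_sub, smul_smul, div_mul_cancel₀ _ hε.ne', sub_smul, one_smul]
    abel
  rw [this]
  have h₁ : δ / ε ≤ 1 := (div_le_one hε).mpr hδ.2.le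
  exact S.add_mem (S.smul_mem (by linarith) hx.1) (S.smul_mem (div_nonneg hδ.1.le hε.le) h)

/-! ### One direction to the minimal face under Slater -/

namespace ConicProgram

variable {E : Type*} [NormedAddCommGroup E] [InnerProductSpace ℝ E] [FiniteDimensional ℝ E] {m : ℕ}
  {S : PointedCone ℝ E} {s : Finset E} {A : E →ₗ[ℝ] EuclideanSpace ℝ (Fin m)}
  {b : EuclideanSpace ℝ (Fin m)} {c : E}

theorem inner_slack {d : E} (hd : A d = 0) (y : EuclideanSpace ℝ (Fin m)) :
    (inner ℝ (c - LinearMap.adjoint A y) d : ℝ) = inner ℝ c d := by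
  rw [inner_sub_left, LinearMap.adjoint_inner_left, hd, inner_zero_right, sub_zero]

theorem mem_innerDual_polyhedralCone {e : E} (he : e ∈ s) {F : Set E}
    (hF : F ⊆ polyhedralCone s) : e ∈ ProperCone.innerDual F :=
  fun _ hx => hF hx e he

/-- A direction that exposes every inequality of `s` that holds with equality at all feasible
slacks. -/
theorem exists_direction_exposing_implicit_equalities (h : PartialPolyhedralSlater S s A c) :
    ∃ z ∈ ProperCone.innerDual ((S : Set E) ∩ polyhedralCone s), A z = 0 ∧ inner ℝ c z = 0 ∧
      ∀ e ∈ s, (∀ y ∈ dualFeasible ((S : Set E) ∩ polyhedralCone s) A c,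
          (inner ℝ (c - LinearMap.adjoint A y) e : ℝ) = 0) →
        ∀ x ∈ reduce ((S : Set E) ∩ polyhedralCone s) z, (inner ℝ x e : ℝ) = 0 := by
  classical
  set F := (S : Set E) ∩ polyhedralCone s with hF
  set I := s.filter fun e => ∀ y ∈ dualFeasible F A c,
    (inner ℝ (c - LinearMap.adjoint A y) e : ℝ) = 0 with hI
  have hex : ∀ e, ∃ x, e ∈ I → x ∈ ProperCone.innerDual F ∧ A x = -A e ∧
      inner ℝ c x ≤ -(inner ℝ c e : ℝ) := by
    intro e
    by_cases he : e ∈ I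
    -- For an implicit equality `e`, the objective `⟪-A e, y⟫` is constantly `-⟪c, e⟫` on the
    -- feasible set. Strong duality with attainment yields `x` such that `x + e` lies in `ker A` and
    -- has nonpositive cost.
    · obtain ⟨x, hx⟩ := exists_primal_le_of_partialPolyhedralSlater (b := -A e)
        (θ := -inner ℝ c e) h (fun y hy => by
          have := (Finset.mem_filter.mp he).2 y hy
          rw [inner_sub_left, LinearMap.adjoint_inner_left] at this
          rw [inner_neg_left, real_inner_comm]
          linarith)
      exact ⟨x, fun _ => hx⟩
    · exact ⟨0, fun h => absurd h he⟩
  choose x hx using hex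
  have hmemF : ∀ e ∈ I, e ∈ ProperCone.innerDual F := fun e he =>
    mem_innerDual_polyhedralCone (Finset.mem_of_mem_filter e he) Set.inter_subset_right
  have hz : ∑ e ∈ I, (x e + e) ∈ ProperCone.innerDual F :=
    Submodule.sum_mem _ fun e he => Submodule.add_mem _ (hx e he).1 (hmemF e he)
  have hAz : A (∑ e ∈ I, (x e + e)) = 0 := by
    rw [map_sum]
    refine Finset.sum_eq_zero fun e he => ?_
    rw [map_add, (hx e he).2.1, neg_add_cancel]
  refine ⟨∑ e ∈ I, (x e + e), hz, hAz, le_antisymm ?_ ?_, fun e he hall v hv => ?_⟩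
  · rw [inner_sum]
    refine Finset.sum_nonpos fun e he => ?_
    rw [inner_add_right]
    linarith [(hx e he).2.2]
  · obtain ⟨y, hy, hy'⟩ := h
    rw [← inner_slack hAz y]
    exact hz ⟨hy.1, hy'⟩
  · have he' : e ∈ I := Finset.mem_filter.mpr ⟨he, hall⟩
    have hsum : (inner ℝ v (∑ e ∈ I, (x e + e)) : ℝ) = 0 := hv.2
    simp only [inner_sum, inner_add_right] at hsum
    have hx0 : ∀ e ∈ I, 0 ≤ (inner ℝ v (x e) : ℝ) := fun e he => (hx e he).1 hv.1
    have he0 : ∀ e ∈ I, 0 ≤ (inner ℝ v e : ℝ) := fun e he => hmemF e he hv.1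
    have := (Finset.sum_eq_zero_iff_of_nonneg
      fun e he => add_nonneg (hx0 e he) (he0 e he)).mp hsum e he'
    linarith [hx0 e he', he0 e he']

/-- A feasible slack in the relative interior of `S` at which only the implicit equalities are
active. -/
theorem exists_slack_strict (h : PartialPolyhedralSlater S s A c) :
    ∃ y, c - LinearMap.adjoint A y ∈ PointedCone.relint S ∧
      c - LinearMap.adjoint A y ∈ polyhedralCone s ∧
      ∀ e ∈ s, (inner ℝ (c - LinearMap.adjoint A y) e : ℝ) = 0 →
        ∀ y' ∈ dualFeasible ((S : Set E) ∩ polyhedralCone s) A c,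
          (inner ℝ (c - LinearMap.adjoint A y') e : ℝ) = 0 := by
  classical
  suffices H : ∀ J ⊆ s, ∃ y, c - LinearMap.adjoint A y ∈ PointedCone.relint S ∧
      c - LinearMap.adjoint A y ∈ polyhedralCone s ∧
      ∀ e ∈ J, (inner ℝ (c - LinearMap.adjoint A y) e : ℝ) = 0 →
        ∀ y' ∈ dualFeasible ((S : Set E) ∩ polyhedralCone s) A c,
          (inner ℝ (c - LinearMap.adjoint A y') e : ℝ) = 0 from H s subset_rfl
  intro J
  induction J using Finset.induction_on with
  | empty =>
    obtain ⟨y, hy, hy'⟩ := h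
    exact fun _ => ⟨y, hy, hy', by simp⟩
  | insert a J _ ih =>
    intro hJ
    obtain ⟨ha, hJ⟩ := Finset.insert_subset_iff.mp hJ
    obtain ⟨y, hy, hy', hall⟩ := ih hJ
    by_cases hex : ∀ y' ∈ dualFeasible ((S : Set E) ∩ polyhedralCone s) A c,
        (inner ℝ (c - LinearMap.adjoint A y') a : ℝ) = 0
    · refine ⟨y, hy, hy', fun e he h0 => ?_⟩
      rcases Finset.mem_insert.mp he with rfl | he
      exacts [hex, hall e he h0]
    · push Not at hex
      obtain ⟨y₁, hy₁, hne⟩ := hex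
      -- Averaging with a point where `a` is inactive keeps the relative interior and every strict
      -- inequality already obtained.
      have hmid : c - LinearMap.adjoint A ((1 / 2 : ℝ) • (y + y₁)) =
          (1 / 2 : ℝ) • ((c - LinearMap.adjoint A y) + (c - LinearMap.adjoint A y₁)) := by
        rw [map_smul, map_add]
        module
      refine ⟨(1 / 2 : ℝ) • (y + y₁), ?_, ?_, fun e he h0 => ?_⟩
      · rw [hmid]
        exact PointedCone.smul_mem_relint (PointedCone.relint_add_mem hy hy₁.1) (by norm_num)
      · rw [hmid]
        exact smul_mem_polyhedralCone (add_mem_polyhedralCone hy' hy₁.2) (by norm_num)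
      · rw [hmid, real_inner_smul_left, inner_add_left] at h0
        have he_s : e ∈ s := by
          rcases Finset.mem_insert.mp he with rfl | he
          exacts [ha, hJ he]
        have h₁ := hy' e he_s
        have h₂ : 0 ≤ (inner ℝ (c - LinearMap.adjoint A y₁) e : ℝ) := hy₁.2 e he_s
        rcases Finset.mem_insert.mp he with rfl | he
        · exact absurd (by linarith) hne
        · exact hall e he (by linarith)

/-- Once the implicit equalities are exposed, the strict slack `x₁` lies in the relative interior of
the remaining face. A candidate direction is nonnegative on the face and zero at `x₁`, hence zero
throughout. If `z` already vanishes on the face, no direction is spent. -/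
theorem exists_genericFRA_of_partialPolyhedralSlater (h : PartialPolyhedralSlater S s A c) :
    ∃ ds M, GenericFRA A c ((S : Set E) ∩ polyhedralCone s) ds M ∧ ds.length ≤ 1 := by
  obtain ⟨z, hz, hAz, hcz, hexp⟩ := exists_direction_exposing_implicit_equalities h
  obtain ⟨y, hy, hy', hstrict⟩ := exists_slack_strict h
  set F := (S : Set E) ∩ polyhedralCone s with hF
  set x₁ := c - LinearMap.adjoint A y with hx₁
  have hx₁z : (inner ℝ x₁ z : ℝ) = 0 := by rw [hx₁, inner_slack hAz, hcz]
  have hx₁F : x₁ ∈ reduce F z := ⟨⟨hy.1, hy'⟩, hx₁z⟩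
  have hmin : GenericFRA A c (reduce F z) [] (reduce F z) := by
    refine .minimal _ ?_ ?_
    · rintro d ⟨hd, hAd, hcd, hnot⟩
      refine hnot fun x hx => le_antisymm ?_ (hd hx)
      have hpoly : ∀ e ∈ s, ∀ᶠ ε : ℝ in nhdsWithin 0 (Set.Ioi 0),
          0 ≤ (inner ℝ (x₁ - ε • x) e : ℝ) := by
        intro e he
        rcases (hy' e he).eq_or_lt with h0 | hpos
        · refine Filter.Eventually.of_forall fun ε => ?_
          rw [inner_sub_left, real_inner_smul_left, ← h0,
            hexp e he (hstrict e he h0.symm) x hx]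
          simp
        · have hcont : Continuous fun ε : ℝ => (inner ℝ (x₁ - ε • x) e : ℝ) := by fun_prop
          have htend := (hcont.tendsto 0).mono_left
            (nhdsWithin_le_nhds (s := Set.Ioi (0 : ℝ)))
          rw [zero_smul, sub_zero] at htend
          filter_upwards [htend.eventually (lt_mem_nhds hpos)] with ε hε using hε.le
      obtain ⟨ε, ⟨hεS, hεs⟩, hε⟩ := (((PointedCone.eventually_sub_smul_mem hy hx.1.1).and
        ((Finset.eventually_all s).mpr hpoly)).and self_mem_nhdsWithin).exists
      have hmem : x₁ - ε • x ∈ reduce F z := by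
        refine ⟨⟨hεS, hεs⟩, ?_⟩
        have hxz : (inner ℝ x z : ℝ) = 0 := hx.2
        change (inner ℝ (x₁ - ε • x) z : ℝ) = 0
        rw [inner_sub_left, real_inner_smul_left, hx₁z, hxz]
        simp
      have h₁ : 0 ≤ (inner ℝ (x₁ - ε • x) d : ℝ) := hd hmem
      rw [inner_sub_left, real_inner_smul_left, inner_slack hAd, hcd] at h₁
      have hε : 0 < ε := hε
      nlinarith
    · rintro d ⟨hd, hAd, hcd⟩
      have h₁ : 0 ≤ (inner ℝ x₁ d : ℝ) := hd hx₁F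
      rw [hx₁, inner_slack hAd] at h₁
      linarith
  by_cases hzF : ∀ x ∈ F, (inner ℝ x z : ℝ) = 0
  · rw [reduce_eq_self hzF] at hmin
    exact ⟨[], F, hmin, by simp⟩
  · exact ⟨[z], reduce F z, .step F z [] _ ⟨hz, hAz, hcz, hzF⟩ hmin, by simp⟩

/-! ### Counting facial reduction steps -/

/-- `PolyhedralDistLE k S`: after any `k` proper facial reductions of `S` a polyhedral cone is
reached. -/
def PolyhedralDistLE : ℕ → PointedCone ℝ E → Prop
  | 0, S => ∃ s : Finset E, (S : Set E) = polyhedralCone s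
  | k + 1, S => ∀ d, (∀ x ∈ S, 0 ≤ (inner ℝ x d : ℝ)) → (∃ x ∈ S, 0 < (inner ℝ x d : ℝ)) →
      ∃ S' : PointedCone ℝ E, (S' : Set E) = reduce S d ∧ PolyhedralDistLE k S'

/-- A polyhedral `S` can be absorbed into the polyhedral part. The remaining cone is the whole
space, which has no proper exposed face, so failure of Slater leaves only an infeasibility
direction. -/
theorem slater_or_infeasible_of_polyhedral (hS : PolyhedralDistLE 0 S) (s : Finset E) :
    ∃ s' : Finset E, (S : Set E) ∩ polyhedralCone s =
        ((⊤ : PointedCone ℝ E) : Set E) ∩ polyhedralCone s' ∧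
      (PartialPolyhedralSlater ⊤ s' A c ∨
        ∃ d, IsInfeasibilityDirection ((S : Set E) ∩ polyhedralCone s) A c d) := by
  classical
  obtain ⟨s₀, hs₀⟩ := hS
  have heq : (S : Set E) ∩ polyhedralCone s =
      ((⊤ : PointedCone ℝ E) : Set E) ∩ polyhedralCone (s₀ ∪ s) := by
    rw [hs₀, polyhedralCone_union]
    simp
  refine ⟨s₀ ∪ s, heq, or_iff_not_imp_left.mpr fun hno => ?_⟩
  rw [heq]
  rcases exists_direction_of_not_partialPolyhedralSlater hno with h | ⟨d, t, hd, ⟨x, -, hx⟩, -⟩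
  · exact h
  · have := hd (-x) Submodule.mem_top
    rw [inner_neg_left] at this
    linarith

theorem reduction_of_not_slater {k : ℕ} (hS : PolyhedralDistLE (k + 1) S)
    (h : ¬ PartialPolyhedralSlater S s A c) :
    (∃ d, IsInfeasibilityDirection ((S : Set E) ∩ polyhedralCone s) A c d) ∨
    ∃ (S' : PointedCone ℝ E) (s' : Finset E), PolyhedralDistLE k S' ∧
      ((S : Set E) ∩ polyhedralCone s = (S' : Set E) ∩ polyhedralCone s' ∨
        ∃ d, IsReducingDirection ((S : Set E) ∩ polyhedralCone s) A c d ∧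
          reduce ((S : Set E) ∩ polyhedralCone s) d = (S' : Set E) ∩ polyhedralCone s') := by
  classical
  rcases exists_direction_of_not_partialPolyhedralSlater h with h | ⟨d, t, hd, hpos, ht, hA, hc⟩
  · exact Or.inl h
  · right
    obtain ⟨S', hS', hk⟩ := hS d hd hpos
    have hred : reduce ((S : Set E) ∩ polyhedralCone s) (d + t) =
        -- As `t` is nonnegative on the polyhedral cone, adding the inequality of `-t` cuts out
        -- exactly `{t}^⊥`.
        (S' : Set E) ∩ polyhedralCone (insert (-t) s) := by
      ext x
      simp only [hS', reduce, polyhedralCone, Set.mem_inter_iff, Set.mem_ofPred_eq,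
        Finset.forall_mem_insert, inner_add_right, inner_neg_right, SetLike.mem_coe]
      constructor
      · rintro ⟨⟨hxS, hxs⟩, h0⟩
        have h₁ := hd x hxS
        have h₂ := ht x hxs
        exact ⟨⟨hxS, by linarith⟩, by linarith, hxs⟩
      · rintro ⟨⟨hxS, h0⟩, h₁, hxs⟩
        have h₂ := ht x hxs
        exact ⟨⟨hxS, hxs⟩, by linarith⟩
    refine ⟨S', insert (-t) s, hk, ?_⟩
    by_cases hF : ∀ x ∈ (S : Set E) ∩ polyhedralCone s, (inner ℝ x (d + t) : ℝ) = 0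
    -- Here `d + t` vanishes on the whole intersection and is not an admissible direction, but the
    -- intersection is then re-expressed with the smaller `S'` at no cost.
    · left
      rw [← hred, reduce_eq_self hF]
    · refine Or.inr ⟨d + t, ⟨fun x hx => ?_, hA, hc, hF⟩, hred⟩
      change 0 ≤ (inner ℝ x _ : ℝ)
      rw [inner_add_right]
      exact add_nonneg (hd x hx.1) (ht x hx.2)

theorem exists_genericFRA_length_le {k : ℕ} (hS : PolyhedralDistLE k S) (s : Finset E) :
    ∃ ds M, GenericFRA A c ((S : Set E) ∩ polyhedralCone s) ds M ∧ ds.length ≤ k + 1 := by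
  induction k generalizing S s with
  | zero =>
    obtain ⟨s', heq, h | ⟨d, hd⟩⟩ := slater_or_infeasible_of_polyhedral (A := A) (c := c) hS s
    · rw [heq]
      exact exists_genericFRA_of_partialPolyhedralSlater h
    · exact ⟨[d], ∅, .infeasible _ d hd, by simp⟩
  | succ k ih =>
    by_cases h : PartialPolyhedralSlater S s A c
    · obtain ⟨ds, M, hrun, hlen⟩ := exists_genericFRA_of_partialPolyhedralSlater h
      exact ⟨ds, M, hrun, by omega⟩
    · rcases reduction_of_not_slater hS h with ⟨d, hd⟩ | ⟨S', s', hk, heq | ⟨d, hd, heq⟩⟩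
      · exact ⟨[d], ∅, .infeasible _ d hd, by simp⟩
      · obtain ⟨ds, M, hrun, hlen⟩ := ih hk s'
        rw [heq]
        exact ⟨ds, M, hrun, by omega⟩
      · obtain ⟨ds, M, hrun, hlen⟩ := ih hk s'
        rw [← heq] at hrun
        exact ⟨d :: ds, M, .step _ d ds M hd hrun, by simpa using hlen⟩

theorem dualFeasible_reduce {F : Set E} {d : E} (hd : A d = 0) (hcd : inner ℝ c d = (0 : ℝ)) :
    dualFeasible (reduce F d) A c = dualFeasible F A c := by
  ext y
  refine ⟨fun h => h.1, fun h => ⟨h, ?_⟩⟩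
  change (inner ℝ _ d : ℝ) = 0
  rw [inner_slack hd, hcd]

theorem dualValue_le_primalValue (F : Set E) : dualValue F A b c ≤ primalValue F A b c := by
  refine iSup₂_le fun y hy => le_iInf₂ fun x hx => ?_
  have h₁ : 0 ≤ (inner ℝ (c - LinearMap.adjoint A y) x : ℝ) := hx.1 hy
  rw [inner_sub_left, LinearMap.adjoint_inner_left, hx.2, real_inner_comm b y] at h₁
  exact_mod_cast (by linarith : (inner ℝ b y : ℝ) ≤ inner ℝ c x)

theorem restoresStrongDuality_of_slater {K : ProperCone ℝ E}
    (hK : dualFeasible ((S : Set E) ∩ polyhedralCone s) A c = dualFeasible (K : Set E) A c)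
    (h : PartialPolyhedralSlater S s A c) :
    RestoresStrongDuality K A b c ((S : Set E) ∩ polyhedralCone s) := by
  set F := (S : Set E) ∩ polyhedralCone s with hF
  have hval : dualValue (K : Set E) A b c = dualValue F A b c := by
    unfold dualValue
    rw [hK]
  unfold RestoresStrongDuality
  rw [hval]
  have hweak := dualValue_le_primalValue (A := A) (b := b) (c := c) F
  obtain ⟨y₀, hy₀⟩ := h
  have hbot : (inner ℝ b y₀ : ℝ) ≤ dualValue F A b c :=
    le_iSup₂ (f := fun y (_ : y ∈ dualFeasible F A c) => ((inner ℝ b y : ℝ) : EReal)) y₀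
      ⟨hy₀.1.1, hy₀.2⟩
  rcases eq_or_ne (dualValue F A b c) ⊤ with htop | htop
  · exact ⟨by rw [htop] at hweak ⊢; exact top_le_iff.mp hweak, fun _ hlt => absurd htop hlt.ne⟩
  · lift dualValue F A b c to ℝ using
      ⟨htop, ((EReal.bot_lt_coe _).trans_le hbot).ne'⟩ with θ hθ
    obtain ⟨x, hx, hAx, hcx⟩ := exists_primal_le_of_partialPolyhedralSlater (b := b) (θ := θ)
      ⟨y₀, hy₀⟩ (fun y hy => by
        have : ((inner ℝ b y : ℝ) : EReal) ≤ θ := by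
          rw [hθ]
          exact le_iSup₂
            (f := fun y (_ : y ∈ dualFeasible F A c) => ((inner ℝ b y : ℝ) : EReal)) y hy
        exact_mod_cast this)
    have hle : primalValue F A b c ≤ ((inner ℝ c x : ℝ) : EReal) :=
      iInf₂_le (f := fun x (_ : x ∈ primalFeasible F A b) => ((inner ℝ c x : ℝ) : EReal)) x
        ⟨hx, hAx⟩
    have hcx' : ((inner ℝ c x : ℝ) : EReal) ≤ θ := by exact_mod_cast hcx
    exact ⟨le_antisymm (hle.trans hcx') hweak, fun _ _ =>
      ⟨x, ⟨hx, hAx⟩, le_antisymm (hcx'.trans hweak) hle⟩⟩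

theorem dualFeasible_eq_empty {F : Set E} {d : E} (hd : IsInfeasibilityDirection F A c d) :
    dualFeasible F A c = ∅ := by
  refine Set.eq_empty_of_forall_notMem fun y hy => ?_
  have h₁ : 0 ≤ (inner ℝ (c - LinearMap.adjoint A y) d : ℝ) := hd.1 hy
  rw [inner_slack hd.2.1] at h₁
  linarith [hd.2.2]

/-- The direction is a primal recession direction of negative cost, so one primal feasible point
sends the primal value to `-∞`, the value of the infeasible dual. -/
theorem restoresStrongDuality_of_infeasible {K : ProperCone ℝ E} {F : Set E} {d : E}
    (hK : dualFeasible F A c = dualFeasible (K : Set E) A c)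
    (hF : (primalFeasible F A b).Nonempty) (hd : IsInfeasibilityDirection F A c d) :
    RestoresStrongDuality K A b c F := by
  have hdual : dualValue (K : Set E) A b c = ⊥ := by
    simp [dualValue, ← hK, dualFeasible_eq_empty hd]
  unfold RestoresStrongDuality
  rw [hdual]
  refine ⟨?_, fun h => absurd h (lt_irrefl _)⟩
  obtain ⟨x, hx, hAx⟩ := hF
  rw [EReal.eq_bot_iff_forall_lt]
  intro r
  have hcd := hd.2.2
  obtain ⟨q, hq, hlt⟩ : ∃ q : ℝ, 0 ≤ q ∧ inner ℝ c x + q * inner ℝ c d < r := by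
    refine ⟨(|inner ℝ c x - r| + 1) / -inner ℝ c d, div_nonneg (by positivity) (by linarith), ?_⟩
    rw [div_neg, neg_mul, div_mul_cancel₀ _ hcd.ne]
    linarith [le_abs_self (inner ℝ c x - r)]
  have hmem : x + q • d ∈ primalFeasible F A b := by
    refine ⟨fun v hv => ?_, by rw [map_add, map_smul, hd.2.1, hAx, smul_zero, add_zero]⟩
    change 0 ≤ (inner ℝ v _ : ℝ)
    rw [inner_add_right, real_inner_smul_right]
    exact add_nonneg (hx hv) (mul_nonneg hq (hd.1 hv))
  refine lt_of_le_of_lt (iInf₂_le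
    (f := fun x (_ : x ∈ primalFeasible F A b) => ((inner ℝ c x : ℝ) : EReal)) _ hmem) ?_
  rw [inner_add_right, real_inner_smul_right]
  exact_mod_cast hlt

theorem exists_reducesTo_restoring {K : ProperCone ℝ E} {k : ℕ} (hS : PolyhedralDistLE k S)
    (s : Finset E)
    (hK : dualFeasible ((S : Set E) ∩ polyhedralCone s) A c = dualFeasible (K : Set E) A c)
    (hfeas : (primalFeasible ((S : Set E) ∩ polyhedralCone s) A b).Nonempty ∨
      (dualFeasible (K : Set E) A c).Nonempty) :
    ∃ ds F, ReducesTo A c ((S : Set E) ∩ polyhedralCone s) ds F ∧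
      RestoresStrongDuality K A b c F ∧ ds.length ≤ k := by
  have hinf : ∀ F d, dualFeasible F A c = dualFeasible (K : Set E) A c →
      ((primalFeasible F A b).Nonempty ∨ (dualFeasible (K : Set E) A c).Nonempty) →
      IsInfeasibilityDirection F A c d → RestoresStrongDuality K A b c F := by
    rintro F d hF (hne | hne) hd
    · exact restoresStrongDuality_of_infeasible hF hne hd
    · rw [← hF, dualFeasible_eq_empty hd] at hne
      exact absurd hne Set.not_nonempty_empty
  induction k generalizing S s with
  | zero =>
    obtain ⟨s', heq, h | ⟨d, hd⟩⟩ := slater_or_infeasible_of_polyhedral (A := A) (c := c) hS s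
    · rw [heq] at hK ⊢
      exact ⟨[], _, .nil _, restoresStrongDuality_of_slater hK h, le_rfl⟩
    · exact ⟨[], _, .nil _, hinf _ d hK hfeas hd, le_rfl⟩
  | succ k ih =>
    by_cases h : PartialPolyhedralSlater S s A c
    · exact ⟨[], _, .nil _, restoresStrongDuality_of_slater hK h, Nat.zero_le _⟩
    · rcases reduction_of_not_slater hS h with ⟨d, hd⟩ | ⟨S', s', hk, heq | ⟨d, hd, heq⟩⟩
      · exact ⟨[], _, .nil _, hinf _ d hK hfeas hd, Nat.zero_le _⟩
      · rw [heq] at hK hfeas ⊢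
        obtain ⟨ds, F, hrun, hF, hlen⟩ := ih hk s' hK hfeas
        exact ⟨ds, F, hrun, hF, by omega⟩
      · rw [← dualFeasible_reduce hd.2.1 hd.2.2.1, heq] at hK
        have hsub : (S' : Set E) ∩ polyhedralCone s' ⊆ (S : Set E) ∩ polyhedralCone s := by
          rw [← heq]
          exact Set.inter_subset_left
        -- Shrinking the face enlarges its dual cone, so primal feasible points stay feasible.
        obtain ⟨ds, F, hrun, hF, hlen⟩ := ih hk s' hK (hfeas.imp_left fun ⟨x, hx, hAx⟩ =>
          ⟨x, fun v hv => hx (hsub hv), hAx⟩)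
        rw [← heq] at hrun
        exact ⟨d :: ds, F, .cons _ d ds F hd hrun, hF, by simpa using hlen⟩

/-- Facial reduction for the intersection of a cone with a polyhedral cone. -/
theorem singularityDegree_le_and_distStrongDuality_le {K : ProperCone ℝ E} {k : ℕ}
    (hS : PolyhedralDistLE k S) (hK : (K : Set E) = (S : Set E) ∩ polyhedralCone s) :
    singularityDegree K A c ≤ ((k + 1 : ℕ) : ℕ∞) ∧
      ((primalFeasible (K : Set E) A b).Nonempty ∨ (dualFeasible (K : Set E) A c).Nonempty →
        distStrongDuality K A b c ≤ (k : ℕ∞)) := by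
  constructor
  · obtain ⟨ds, M, hrun, hlen⟩ := exists_genericFRA_length_le (A := A) (c := c) hS s
    rw [← hK] at hrun
    exact sInf_le_of_le ⟨ds, M, hrun, rfl⟩ (by exact_mod_cast hlen)
  · intro hfeas
    obtain ⟨ds, F, hrun, hF, hlen⟩ := exists_reducesTo_restoring (K := K) (A := A) (b := b)
      (c := c) hS s (by rw [← hK]) (by rwa [← hK])
    rw [← hK] at hrun
    exact sInf_le_of_le ⟨ds, F, hrun, hF, rfl⟩ (by exact_mod_cast hlen)

end ConicProgram

/-! ### Rays are polyhedral -/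

namespace ConicProgram

/-- A ray is polyhedral. -/
theorem exists_polyhedralCone_eq_ray {E : Type*} [NormedAddCommGroup E] [InnerProductSpace ℝ E]
    [FiniteDimensional ℝ E] (w : E) :
    ∃ s : Finset E, polyhedralCone s = {x | ∃ r : ℝ, 0 ≤ r ∧ x = r • w} := by
  classical
  set V := (ℝ ∙ w)ᗮ
  let B := stdOrthonormalBasis ℝ V
  let t : Finset E := Finset.univ.image fun i => (B i : E)
  -- The vectors of `t` and their negatives force membership in the line of `w`; `w` itself fixes
  -- the sign.
  refine ⟨insert w (t ∪ t.image Neg.neg), ?_⟩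
  ext x
  constructor
  · intro hx
    have hxw := hx w (Finset.mem_insert_self _ _)
    have hxB : ∀ i, (inner ℝ (B i : E) x : ℝ) = 0 := by
      intro i
      have hi : (B i : E) ∈ t := Finset.mem_image_of_mem _ (Finset.mem_univ i)
      have h₁ := hx (B i) (by simp [hi])
      have h₂ := hx (-B i) (Finset.mem_insert_of_mem
        (Finset.mem_union_right _ (Finset.mem_image_of_mem _ hi)))
      rw [inner_neg_right] at h₂
      rw [real_inner_comm]
      linarith
    have hxV : x ∈ Vᗮ := by
      rw [Submodule.mem_orthogonal]
      intro v hv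
      have hsum := B.sum_repr ⟨v, hv⟩
      have : v = ∑ i, B.repr ⟨v, hv⟩ i • (B i : E) := by
        have := congrArg Subtype.val hsum
        simpa using this.symm
      rw [this, sum_inner]
      exact Finset.sum_eq_zero fun i _ => by rw [real_inner_smul_left, hxB, mul_zero]
    rw [Submodule.orthogonal_orthogonal, Submodule.mem_span_singleton] at hxV
    obtain ⟨r, rfl⟩ := hxV
    rcases eq_or_ne w 0 with rfl | hw
    · exact ⟨0, le_rfl, by simp⟩
    · rw [real_inner_smul_left] at hxw
      exact ⟨r, nonneg_of_mul_nonneg_left hxw (real_inner_self_pos.mpr hw), rfl⟩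
  · rintro ⟨r, hr, rfl⟩
    have hB : ∀ i, (inner ℝ w (B i : E) : ℝ) = 0 := fun i =>
      Submodule.mem_orthogonal_singleton_iff_inner_right.mp (B i).2
    intro e he
    rw [real_inner_smul_left]
    refine mul_nonneg hr ?_
    simp only [t, Finset.mem_insert, Finset.mem_union, Finset.mem_image, Finset.mem_univ,
      true_and] at he
    rcases he with rfl | ⟨i, rfl⟩ | ⟨_, ⟨i, rfl⟩, rfl⟩
    · exact real_inner_self_nonneg
    · exact (hB i).ge
    · rw [inner_neg_right, hB, neg_zero]

end ConicProgram

/-! ### Faces of the semidefinite cone -/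

namespace SymMat

variable {n : ℕ}

/-- The symmetric matrix `u uᵀ`. -/
def rankOne (u : Fin n → ℝ) : SymMat n :=
  ⟨Matrix.vecMulVec u u, by
    change (Matrix.vecMulVec u u)ᵀ = _
    rw [Matrix.transpose_vecMulVec]⟩

theorem mat_rankOne (u : Fin n → ℝ) : (rankOne u).mat = Matrix.vecMulVec u u := rfl

theorem inner_rankOne (u : Fin n → ℝ) (D : SymMat n) :
    (inner ℝ (rankOne u) D : ℝ) = u ⬝ᵥ (D.mat *ᵥ u) := by
  rw [inner_def, mat_rankOne, Matrix.trace_mul_comm, Matrix.mul_vecMulVec, Matrix.trace_vecMulVec,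
    dotProduct_comm]

theorem rankOne_smul (r : ℝ) (u : Fin n → ℝ) : rankOne (r • u) = r ^ 2 • rankOne u := by
  ext i j
  simp [mat_rankOne, Matrix.vecMulVec_apply]
  ring

theorem rankOne_add_rankOne_sub (u v : Fin n → ℝ) :
    rankOne (u + v) + rankOne (u - v) = (2 : ℝ) • (rankOne u + rankOne v) := by
  ext i j
  simp [mat_rankOne, Matrix.vecMulVec_apply]
  ring

/-- The face of the positive semidefinite cone that consists of the matrices with range in `U`. -/
def psdFace (U : Submodule ℝ (Fin n → ℝ)) : PointedCone ℝ (SymMat n) :=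
  PointedCone.hull ℝ (rankOne '' (U : Set (Fin n → ℝ)))

theorem rankOne_mem_psdFace {U : Submodule ℝ (Fin n → ℝ)} {u : Fin n → ℝ} (hu : u ∈ U) :
    rankOne u ∈ psdFace U :=
  Submodule.subset_span (Set.mem_image_of_mem _ hu)

theorem psdFace_mono {U W : Submodule ℝ (Fin n → ℝ)} (h : U ≤ W) : psdFace U ≤ psdFace W :=
  Submodule.span_mono (Set.image_mono h)

open scoped MatrixOrder ComplexOrder in
theorem _root_.Matrix.PosSemidef.exists_eq_conjTranspose_mul_self
    {X : Matrix (Fin n) (Fin n) ℝ} (hX : X.PosSemidef) :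
    ∃ B : Matrix (Fin n) (Fin n) ℝ, X = Bᴴ * B :=
  CStarAlgebra.nonneg_iff_eq_star_mul_self.mp hX.nonneg

theorem coe_psdFace_top : (psdFace (⊤ : Submodule ℝ (Fin n → ℝ)) : Set (SymMat n)) = psdCone n := by
  ext X
  constructor
  · intro hX
    induction hX using Submodule.span_induction with
    | mem x hx =>
      obtain ⟨u, -, rfl⟩ := hx
      have := Matrix.posSemidef_vecMulVec_self_star u
      rwa [star_trivial] at this
    | zero => exact (psdCone n).zero_mem
    | add x y _ _ hx hy => exact (psdCone n).add_mem hx hy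
    | smul r x _ hx => exact (psdCone n).smul_mem hx r.2
  · intro hX
    obtain ⟨B, hB⟩ := (show X.mat.PosSemidef from hX).exists_eq_conjTranspose_mul_self
    have hsum : X = ∑ k, rankOne (B k) := by
      ext i j
      change X.mat i j = matₗ n (∑ k, rankOne (B k)) i j
      rw [hB, map_sum, Matrix.sum_apply, Matrix.mul_apply]
      rfl
    rw [hsum]
    exact Submodule.sum_mem _ fun k _ => rankOne_mem_psdFace Submodule.mem_top

/-- The vectors of `U` at which the quadratic form of `D` vanishes, when it is nonnegative on `U`. -/
def isotropicSubmodule (U : Submodule ℝ (Fin n → ℝ)) (D : SymMat n)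
    (hD : ∀ X ∈ psdFace U, 0 ≤ (inner ℝ X D : ℝ)) : Submodule ℝ (Fin n → ℝ) where
  carrier := {u | u ∈ U ∧ (inner ℝ (rankOne u) D : ℝ) = 0}
  add_mem' := by
    rintro u v ⟨hu, hu0⟩ ⟨hv, hv0⟩
    refine ⟨U.add_mem hu hv, ?_⟩
    have h₁ := hD _ (rankOne_mem_psdFace (U.add_mem hu hv))
    have h₂ := hD _ (rankOne_mem_psdFace (U.sub_mem hu hv))
    -- By the parallelogram identity, the nonnegative values at `u + v` and `u - v` sum to zero.
    have h₃ := congrArg (fun X => (inner ℝ X D : ℝ)) (rankOne_add_rankOne_sub u v)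
    simp only [inner_add_left, real_inner_smul_left, hu0, hv0] at h₃
    linarith
  zero_mem' := ⟨U.zero_mem, by rw [inner_rankOne, zero_dotProduct]⟩
  smul_mem' := by
    rintro r u ⟨hu, hu0⟩
    exact ⟨U.smul_mem r hu, by rw [rankOne_smul, real_inner_smul_left, hu0, mul_zero]⟩

theorem isotropicSubmodule_le (U : Submodule ℝ (Fin n → ℝ)) (D : SymMat n)
    (hD : ∀ X ∈ psdFace U, 0 ≤ (inner ℝ X D : ℝ)) : isotropicSubmodule U D hD ≤ U :=
  fun _ h => h.1

/-- `D` is nonnegative on every generator `u uᵀ`, so a conic combination orthogonal to `D` uses only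
generators orthogonal to `D`. -/
theorem coe_psdFace_isotropicSubmodule (U : Submodule ℝ (Fin n → ℝ)) (D : SymMat n)
    (hD : ∀ X ∈ psdFace U, 0 ≤ (inner ℝ X D : ℝ)) :
    (psdFace (isotropicSubmodule U D hD) : Set (SymMat n)) =
      ConicProgram.reduce (psdFace U) D := by
  ext X
  constructor
  · refine fun hX => ⟨psdFace_mono (isotropicSubmodule_le U D hD) hX, ?_⟩
    change (inner ℝ X D : ℝ) = 0
    induction hX using Submodule.span_induction with
    | mem x hx =>
      obtain ⟨u, hu, rfl⟩ := hx
      exact hu.2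
    | zero => exact inner_zero_left _
    | add x y _ _ hx hy => rw [inner_add_left, hx, hy, add_zero]
    | smul r x _ hx =>
      change (inner ℝ ((r : ℝ) • x) D : ℝ) = 0
      rw [real_inner_smul_left, hx, mul_zero]
  · rintro ⟨hX, hX0⟩
    replace hX0 : (inner ℝ X D : ℝ) = 0 := hX0
    induction hX using Submodule.span_induction with
    | mem x hx =>
      obtain ⟨u, hu, rfl⟩ := hx
      exact rankOne_mem_psdFace ⟨hu, hX0⟩
    | zero => exact Submodule.zero_mem _
    | add x y hxm hym hx hy =>
      rw [inner_add_left] at hX0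
      have h₁ := hD x hxm
      have h₂ := hD y hym
      exact Submodule.add_mem _ (hx (by linarith)) (hy (by linarith))
    | smul r x _ hx =>
      change (inner ℝ ((r : ℝ) • x) D : ℝ) = 0 at hX0
      rw [real_inner_smul_left] at hX0
      rcases mul_eq_zero.mp hX0 with h | h
      · have : r = 0 := Subtype.ext h
        rw [this, zero_smul]
        exact Submodule.zero_mem _
      · exact Submodule.smul_mem _ r (hx h)

/-- A proper reduction replaces `U` by a strictly smaller subspace. When the dimension is at most
one, the face is a ray, possibly zero. -/
theorem polyhedralDistLE_psdFace (k : ℕ) (U : Submodule ℝ (Fin n → ℝ))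
    (hU : Module.finrank ℝ U ≤ k + 1) : ConicProgram.PolyhedralDistLE k (psdFace U) := by
  induction k generalizing U with
  | zero =>
    obtain ⟨⟨v, hv⟩, hspan⟩ := finrank_le_one_iff.mp hU
    obtain ⟨s, hs⟩ := ConicProgram.exists_polyhedralCone_eq_ray (rankOne v)
    refine ⟨s, ?_⟩
    rw [hs]
    ext X
    constructor
    · intro hX
      induction hX using Submodule.span_induction with
      | mem x hx =>
        obtain ⟨u, hu, rfl⟩ := hx
        obtain ⟨r, hr⟩ := hspan ⟨u, hu⟩
        have hr' : r • v = u := congrArg Subtype.val hr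
        exact ⟨r ^ 2, sq_nonneg r, by rw [← hr', rankOne_smul]⟩
      | zero => exact ⟨0, le_rfl, (zero_smul _ _).symm⟩
      | add x y _ _ hx hy =>
        obtain ⟨p, hp, rfl⟩ := hx
        obtain ⟨q, hq, rfl⟩ := hy
        exact ⟨p + q, add_nonneg hp hq, (add_smul _ _ _).symm⟩
      | smul r x _ hx =>
        obtain ⟨p, hp, rfl⟩ := hx
        exact ⟨r * p, mul_nonneg r.2 hp, smul_smul (r : ℝ) p _⟩
    · rintro ⟨r, hr, rfl⟩
      exact PointedCone.smul_mem _ hr (rankOne_mem_psdFace hv)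
  | succ k ih =>
    rintro D hD ⟨X, hX, hpos⟩
    refine ⟨_, coe_psdFace_isotropicSubmodule U D hD, ih _ ?_⟩
    have hlt : isotropicSubmodule U D hD < U := by
      refine (isotropicSubmodule_le U D hD).lt_of_ne fun heq => ?_
      have hX' : X ∈ (psdFace (isotropicSubmodule U D hD) : Set (SymMat n)) := by
        rw [heq]
        exact hX
      rw [coe_psdFace_isotropicSubmodule] at hX'
      exact hpos.ne' hX'.2
    have := Submodule.finrank_lt_finrank_of_lt hlt
    omega

theorem exists_coe_nonnegCone_eq_polyhedralCone (n : ℕ) :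
    ∃ s : Finset (SymMat n), (nonnegCone n : Set (SymMat n)) = ConicProgram.polyhedralCone s := by
  classical
  -- Matrix units are symmetrised to lie in the space; the pairing is twice the entry, on the
  -- diagonal too.
  let e : Fin n × Fin n → SymMat n := fun p =>
    ⟨Matrix.single p.1 p.2 1 + Matrix.single p.2 p.1 1, by
      change (_ : Matrix (Fin n) (Fin n) ℝ)ᵀ = _
      rw [Matrix.transpose_add, Matrix.transpose_single, Matrix.transpose_single, add_comm]⟩
  have he : ∀ (X : SymMat n) p, (inner ℝ X (e p) : ℝ) = 2 * X.mat p.1 p.2 := by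
    intro X p
    have hsymm : X.mat p.2 p.1 = X.mat p.1 p.2 := X.isSymm.apply p.1 p.2
    change (X.mat * (Matrix.single p.1 p.2 1 + Matrix.single p.2 p.1 1)).trace = _
    rw [Matrix.mul_add, Matrix.trace_add, Matrix.trace_mul_single, Matrix.trace_mul_single]
    simp [hsymm]
    ring
  refine ⟨Finset.univ.image e, ?_⟩
  ext X
  constructor
  · intro hX v hv
    obtain ⟨q, -, rfl⟩ := Finset.mem_image.mp hv
    rw [he]
    exact mul_nonneg zero_le_two (hX q.1 q.2)
  · intro hX i j
    have := hX _ (Finset.mem_image_of_mem e (Finset.mem_univ (i, j)))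
    rw [he] at this
    linarith

end SymMat

end

theorem mainTheorem8 (n m : ℕ) (hn : 1 ≤ n) (A : SymMat n →ₗ[ℝ] EuclideanSpace ℝ (Fin m))
    (b : EuclideanSpace ℝ (Fin m)) (c : SymMat n) :
    ConicProgram.singularityDegree (dnnCone n) A c ≤ (n : ℕ∞) ∧
      ((ConicProgram.primalFeasible (dnnCone n : Set (SymMat n)) A b).Nonempty ∨
          (ConicProgram.dualFeasible (dnnCone n : Set (SymMat n)) A c).Nonempty →
        ConicProgram.distStrongDuality (dnnCone n) A b c ≤ ((n - 1 : ℕ) : ℕ∞)) := by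
  obtain ⟨s, hs⟩ := SymMat.exists_coe_nonnegCone_eq_polyhedralCone n
  have hdist := SymMat.polyhedralDistLE_psdFace (n - 1) (⊤ : Submodule ℝ (Fin n → ℝ))
    (by rw [finrank_top, Module.finrank_fin_fun]; omega)
  have hK : (dnnCone n : Set (SymMat n)) =
      (SymMat.psdFace (⊤ : Submodule ℝ (Fin n → ℝ)) : Set (SymMat n)) ∩
        ConicProgram.polyhedralCone s := by
    rw [SymMat.coe_psdFace_top, ← hs]
    rfl
  have := ConicProgram.singularityDegree_le_and_distStrongDuality_le (A := A) (b := b) (c := c)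
    hdist hK
  rwa [Nat.sub_add_cancel hn] at this
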